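/- Let $X\subseteq\mathbb R^d$ be closed and let $\rho$ be a Borel probability measure on $X\times\mathbb R$ with $\int y^2\,d\rho<\infty$. Denote by $\rho_X$ its marginal on $X$ and by $\rho(\cdot\mid x)$ its conditional distribution given $x$; let $\|f\|_\rho=\big(\int_X |f|^2\,d\rho_X\big)^{1/2}$, $\mathcal E(f)=\int (f(x)-y)^2\,d\rho(x,y)$, and let $f_\rho(x)=\int y\,d\rho(y\mid x)$ be the regression function. Let $\mu$ be a probability measure on a measurable space $V$ and let $\phi:V\times X\to\mathbb R$, $\phi_v(x)=\phi(v,x)$, be a measurable function, square-integrable with respect to $\mu\otimes\rho_X$, with $\phi(\cdot,x)\in L^2_\mu$ for every $x\in X$. Let $$K(x,x')=\int_V \phi(v,x)\,\phi(v,x')\,d\mu(v)\qquad (x,x'\in X),$$ and let $(\mathcal H_K,\|\cdot\|_K)$ be the reproducing kernel Hilbert space of functions on $X$ with kernel $K$. Assume that $\mathcal H_K$ is separable, that $K$ is measurable, and that for some $\kappa\ge 1$ $$K(x,x)\le\kappa^2\ \text{ for } \rho_X\text{-a.e. } x,\qquad \phi_v(x)\,\phi_v(x')\le\kappa^2\ \text{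 for } \mu\otimes\rho_X\otimes\rho_X\text{-a.e. } (v,x,x').$$ Assume that $f_\rho\in\mathcal H_K$, in the sense that there is $f_*\in\mathcal H_K$ with $f_*=f_\rho$ $\rho_X$-almost everywhere, and let $R\ge\|f_*\|_K$. Let $T\ge 2$ be an integer, let $z_t=(x_t,y_t)$, $t=1,\dots,T$, be i.i.d. with law $\rho$, let $v_1,\dots,v_T$ be i.i.d. with law $\mu$ and independent of the $z_t$, and define $f_1=0$ and $$f_{t+1}=f_t-\eta_t\,(f_t(x_t)-y_t)\,\phi_{v_t}(x_t)\,\phi_{v_t},\qquad \eta_t=\frac{1}{24\,\kappa^4\,\sqrt[3]{T^2}},\qquad t=1,\dots,T.$$ Then $$\mathbb E\big[\|f_{T+1}-f_\rho\|_\rho^2\big]\le C\,T^{-1/3}\ln T,$$ where the constant $C$ depends only on $\kappa$, $R$, $\|f_\rho\|_\rho$ and $\mathcal E(f_\rho)$. -/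

import Mathlib

open MeasureTheory ProbabilityTheory

/-- The regression function `f_ρ(x) = ∫ y dρ(y | x)`, where `ρ(· | x)` is the regular conditional
distribution of the output given the input. -/
noncomputable def regressionFunction {X : Type*} [MeasurableSpace X]
    (ρ : Measure (X × ℝ)) [IsFiniteMeasure ρ] (x : X) : ℝ :=
  ∫ y, y ∂(ρ.condKernel x)

/-- The expected risk `ℰ(f) = ∫ (f(x) - y)² dρ(x, y)` of the square loss. -/
noncomputable def expectedRisk {X : Type*} [MeasurableSpace X]
    (ρ : Measure (X × ℝ)) (f : X → ℝ) : ℝ :=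
  ∫ z, (f z.1 - z.2) ^ 2 ∂ρ

/-- The doubly stochastic learning algorithm with features `φ`, regularization parameter `lam`,
step sizes `η`, samples `z t = (x_t, y_t)` and random feature parameters `v t`, `t ≥ 1`:
`f_1 = 0` and
`f_{t+1} = (1 - η_t lam) f_t - η_t (f_t(x_t) - y_t) φ_{v_t}(x_t) φ_{v_t}` for `t ≥ 1`.
The value at index `0` is a placeholder. -/
noncomputable def doublyStochasticIterate {X V : Type*} (φ : V → X → ℝ) (lam : ℝ) (η : ℕ → ℝ)
    (z : ℕ → X × ℝ) (v : ℕ → V) : ℕ → X → ℝ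
  | 0 => fun _ => 0
  | 1 => fun _ => 0
  | t + 2 => fun x =>
      (1 - η (t + 1) * lam) * doublyStochasticIterate φ lam η z v (t + 1) x
        - η (t + 1)
          * (doublyStochasticIterate φ lam η z v (t + 1) (z (t + 1)).1 - (z (t + 1)).2)
          * φ (v (t + 1)) (z (t + 1)).1 * φ (v (t + 1)) x

/-! Let `J` be the inclusion of the RKHS in `L²(ρ_X)` and `A = I - η J J†`. The operator `J J†` is
the integral operator of `K`, hence the mean over `v` of the rank-one operators `⟨·, φ_v⟩ φ_v`
(`RKHS.inner_inclusion_adjoint`). One stochastic step therefore sends the error `e = f_t - f_ρ` to a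
random `e'` with mean `A e`. Expanding the square after `s` further applications of `A` gives `E‖A^s
e'‖² ≤ ‖A^(s+1) e‖² + η²κ⁴ (‖e‖² + ℰ(f_ρ))` (`lintegral_featureStep_le`).

Unrolling this trades every stochastic step for a deterministic one at a cost of order `η²κ⁴`. As
long as `T η²κ⁴ ≤ 1/4` the errors stay bounded in mean square, and the final error is at most `‖A^T
f_ρ‖² + T η²κ⁴ (2‖f_ρ‖² + 3ℰ(f_ρ))` (`lintegral_tupleIterate_le`). The bias is at most `‖f_*‖_K² /
(ηT)` (`norm_gradientContraction_pow_map_le`). With `η` of order `T^(-2/3)` both terms are of order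
`T^(-1/3)`; the logarithm is slack.

The features are bounded only almost everywhere, so the analysis runs on features truncated to `[-κ,
κ]`, whose iterates almost surely agree with the original ones in `L²` (`tupleIterate_congr_ae`). -/

/-! ### Deterministic gradient descent in Hilbert space. -/

section Hilbert

variable {H E : Type*} [NormedAddCommGroup H] [InnerProductSpace ℝ H] [CompleteSpace H]
  [NormedAddCommGroup E] [InnerProductSpace ℝ E] [CompleteSpace E]

/-- One gradient step for the least-squares functional with positive operator `J J†`. -/
noncomputable def gradientContraction (J : H →L[ℝ] E) (η : ℝ) : E →L[ℝ] E :=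
  ContinuousLinearMap.id ℝ E - η • (J ∘L J.adjoint)

lemma gradientContraction_apply (J : H →L[ℝ] E) (η : ℝ) (e : E) :
    gradientContraction J η e = e - η • J (J.adjoint e) := by
  simp [gradientContraction]

lemma inner_gradientContraction (J : H →L[ℝ] E) (η : ℝ) (u w : E) :
    inner ℝ (gradientContraction J η u) w = inner ℝ u (gradientContraction J η w) := by
  simp only [gradientContraction_apply, inner_sub_left, inner_sub_right, real_inner_smul_left,
    real_inner_smul_right]
  rw [← ContinuousLinearMap.adjoint_inner_right J, ← ContinuousLinearMap.adjoint_inner_left J]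

lemma inner_gradientContraction_pow (J : H →L[ℝ] E) (η : ℝ) (s : ℕ) (u w : E) :
    inner ℝ ((gradientContraction J η ^ s) u) w
      = inner ℝ u ((gradientContraction J η ^ s) w) := by
  induction s generalizing u w with
  | zero => simp
  | succ s ih =>
    rw [pow_succ, mul_apply_eq_comp, ih, inner_gradientContraction, ← mul_apply_eq_comp,
      ← pow_succ', ← pow_succ]

/-- The cross term of `‖u - η J J† u‖²` is `-2η‖J† u‖²`, and the step-size condition bounds the
quadratic term by `η‖J† u‖²`. -/
lemma norm_gradientContraction_le (J : H →L[ℝ] E) {η : ℝ} (h0 : 0 ≤ η) (h1 : η * ‖J‖ ^ 2 ≤ 1)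
    (u : E) : ‖gradientContraction J η u‖ ≤ ‖u‖ := by
  rw [← sq_le_sq₀ (norm_nonneg _) (norm_nonneg _), gradientContraction_apply, norm_sub_sq_real,
    real_inner_smul_right, ← ContinuousLinearMap.adjoint_inner_left, real_inner_self_eq_norm_sq,
    norm_smul, Real.norm_of_nonneg h0]
  have h2 : ‖J (J.adjoint u)‖ ^ 2 ≤ ‖J‖ ^ 2 * ‖J.adjoint u‖ ^ 2 := by
    rw [← mul_pow]; gcongr; exact J.le_opNorm _
  have h3 : (η * ‖J (J.adjoint u)‖) ^ 2 ≤ η * ‖J.adjoint u‖ ^ 2 := by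
    calc (η * ‖J (J.adjoint u)‖) ^ 2 = η ^ 2 * ‖J (J.adjoint u)‖ ^ 2 := by ring
      _ ≤ η ^ 2 * (‖J‖ ^ 2 * ‖J.adjoint u‖ ^ 2) := by gcongr
      _ = (η * ‖J‖ ^ 2) * (η * ‖J.adjoint u‖ ^ 2) := by ring
      _ ≤ 1 * (η * ‖J.adjoint u‖ ^ 2) := by gcongr
      _ = _ := one_mul _
  nlinarith [mul_nonneg h0 (sq_nonneg ‖J.adjoint u‖)]

lemma norm_gradientContraction_pow_le (J : H →L[ℝ] E) {η : ℝ} (h0 : 0 ≤ η)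
    (h1 : η * ‖J‖ ^ 2 ≤ 1) (s : ℕ) (u : E) : ‖(gradientContraction J η ^ s) u‖ ≤ ‖u‖ := by
  induction s with
  | zero => simp
  | succ s ih =>
    rw [pow_succ', mul_apply_eq_comp]
    exact (norm_gradientContraction_le J h0 h1 _).trans ih

/-- Gradient descent from `J f` decreases the squared error at rate `1 / (η n)`. -/
lemma norm_gradientContraction_pow_map_le (J : H →L[ℝ] E) {η : ℝ} (h0 : 0 ≤ η)
    (h1 : η * ‖J‖ ^ 2 ≤ 1) (n : ℕ) (f : H) :
    η * n * ‖(gradientContraction J η ^ n) (J f)‖ ^ 2 ≤ ‖f‖ ^ 2 := by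
  -- The descent from `J f` lifts to descent in `H` with `J† J`. The potential `η n ‖J g‖² + ‖g‖²`
  -- does not increase: `‖g‖²` drops by at least `η‖J g‖²` per step, and `‖J g‖` does not grow.
  suffices h : ∃ g : H, (gradientContraction J η ^ n) (J f) = J g ∧
      η * n * ‖J g‖ ^ 2 + ‖g‖ ^ 2 ≤ ‖f‖ ^ 2 by
    obtain ⟨g, hg, hle⟩ := h
    rw [hg]
    nlinarith [sq_nonneg ‖g‖]
  induction n with
  | zero => exact ⟨f, by simp⟩
  | succ n ih =>
    obtain ⟨g, hg, hle⟩ := ih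
    have hJ : (gradientContraction J η ^ (n + 1)) (J f) = J (g - η • J.adjoint (J g)) := by
      rw [pow_succ', mul_apply_eq_comp, hg, gradientContraction_apply]
      simp
    refine ⟨_, hJ, ?_⟩
    have hdec : ‖J (g - η • J.adjoint (J g))‖ ^ 2 ≤ ‖J g‖ ^ 2 := by
      have := norm_gradientContraction_le J h0 h1 (J g)
      rw [gradientContraction_apply] at this
      rw [map_sub, map_smul]
      gcongr
    have hg' : ‖g - η • J.adjoint (J g)‖ ^ 2 ≤ ‖g‖ ^ 2 - η * ‖J g‖ ^ 2 := by
      rw [norm_sub_sq_real, real_inner_smul_right, ContinuousLinearMap.adjoint_inner_right,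
        real_inner_self_eq_norm_sq, norm_smul, Real.norm_of_nonneg h0]
      have h2 : ‖J.adjoint (J g)‖ ≤ ‖J‖ * ‖J g‖ := by
        have := J.adjoint.le_opNorm (J g)
        rwa [LinearIsometryEquiv.norm_map] at this
      have h3 : (η * ‖J.adjoint (J g)‖) ^ 2 ≤ η * ‖J g‖ ^ 2 := by
        calc (η * ‖J.adjoint (J g)‖) ^ 2 ≤ (η * (‖J‖ * ‖J g‖)) ^ 2 := by gcongr
          _ = (η * ‖J‖ ^ 2) * (η * ‖J g‖ ^ 2) := by ring
          _ ≤ 1 * (η * ‖J g‖ ^ 2) := by gcongr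
          _ = _ := one_mul _
      linarith
    have : η * ((n + 1 : ℕ) : ℝ) * ‖J (g - η • J.adjoint (J g))‖ ^ 2
        ≤ η * ((n + 1 : ℕ) : ℝ) * ‖J g‖ ^ 2 := by gcongr
    push_cast at this ⊢
    nlinarith

end Hilbert

/-! ### Measurable dependence of `L²` classes on a parameter. -/

section Measurability

variable {W X : Type*} [MeasurableSpace W] [MeasurableSpace X]

/-- A jointly measurable family of square-integrable functions depends measurably on the parameter,
as tested by continuous functionals on `L²`. -/
lemma measurable_continuous_comp_toLp [MeasurableSpace.CountablyGenerated X]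
    {m : Measure X} [IsFiniteMeasure m] {F : W → X → ℝ} (hF : Measurable (Function.uncurry F))
    (hF2 : ∀ w, MemLp (F w) 2 m) {G : Lp ℝ 2 m → ℝ} (hG : Continuous G) :
    Measurable (fun w => G ((hF2 w).toLp)) := by
  -- Distances to a fixed element are measurable by Tonelli.
  have hdist (g : Lp ℝ 2 m) : Measurable (fun w => dist ((hF2 w).toLp) g) := by
    have h (w : W) : dist ((hF2 w).toLp) g
        = ((∫⁻ x, ‖F w x - g x‖ₑ ^ (2 : ℝ) ∂m) ^ (1 / 2 : ℝ)).toReal := by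
      have : eLpNorm (fun x => F w x - g x) 2 m
          = (∫⁻ x, ‖F w x - g x‖ₑ ^ (2 : ℝ) ∂m) ^ (1 / 2 : ℝ) := by
        rw [eLpNorm_eq_lintegral_rpow_enorm_toReal (by simp) (by simp)]
        simp
      rw [← this, Lp.dist_def]
      congr 1
      refine eLpNorm_congr_ae ?_
      filter_upwards [(hF2 w).coeFn_toLp] with x hx
      simp [hx]
    simp_rw [h]
    refine ENNReal.measurable_toReal.comp (Measurable.pow_const ?_ _)
    refine Measurable.lintegral_prod_right'
      (f := fun p : W × X => ‖F p.1 p.2 - g p.2‖ₑ ^ (2 : ℝ)) ?_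
    have hg : Measurable g := (Lp.stronglyMeasurable g).measurable
    exact ((hF.sub (hg.comp measurable_snd)).enorm).pow_const _
  -- `L²` is second countable here, so the open preimage of `U` is a countable union of balls, and
  -- distances suffice.
  refine measurable_of_isOpen fun U hU => ?_
  have hV : IsOpen (G ⁻¹' U) := hU.preimage hG
  have hr (g : G ⁻¹' U) : ∃ r > 0, Metric.ball (g : Lp ℝ 2 m) r ⊆ G ⁻¹' U :=
    Metric.isOpen_iff.1 hV g g.2
  choose r hr0 hr using hr
  have hUn : G ⁻¹' U = ⋃ g : G ⁻¹' U, Metric.ball (g : Lp ℝ 2 m) (r g) :=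
    Set.Subset.antisymm (fun g hg => Set.mem_iUnion.2 ⟨⟨g, hg⟩, Metric.mem_ball_self (hr0 _)⟩)
      (Set.iUnion_subset hr)
  have : Fact ((2 : ENNReal) ≠ ⊤) := ⟨by simp⟩
  obtain ⟨S, hS, hSU⟩ := TopologicalSpace.isOpen_iUnion_countable
    (fun g : G ⁻¹' U => Metric.ball (g : Lp ℝ 2 m) (r g)) fun _ => Metric.isOpen_ball
  have : (fun w => G ((hF2 w).toLp)) ⁻¹' U
      = ⋃ g ∈ S, (fun w => dist ((hF2 w).toLp) (g : Lp ℝ 2 m)) ⁻¹' Set.Iio (r g) := by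
    ext w
    have := Set.ext_iff.1 (hUn.trans hSU.symm) ((hF2 w).toLp)
    simpa only [Set.mem_preimage, Set.mem_iUnion, Metric.mem_ball, Set.mem_Iio] using this
  rw [this]
  exact MeasurableSet.biUnion hS fun g _ => hdist g measurableSet_Iio

end Measurability

/-! ### Iterates as functions of finitely many samples. -/

section Iterates

variable {X V : Type*}

/-- One step of unregularized doubly stochastic gradient descent. -/
def featureStep (φ : V → X → ℝ) (η : ℝ) (f : X → ℝ) (p : (X × ℝ) × V) : X → ℝ :=
  fun x => f x - η * (f p.1.1 - p.1.2) * φ p.2 p.1.1 * φ p.2 x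

/-- The iterate of unregularized doubly stochastic gradient descent after a finite sequence of
samples. -/
def tupleIterate (φ : V → X → ℝ) (η : ℝ) : (n : ℕ) → (Fin n → (X × ℝ) × V) → X → ℝ
  | 0, _ => fun _ => 0
  | n + 1, w => featureStep φ η (tupleIterate φ η n (Fin.init w)) (w (Fin.last n))

/-- Samples are numbered from 1 and `f_1 = 0`, so `f_(n+1)` has used `n` samples, with sample `i +
1` at position `i` of the tuple. -/
lemma doublyStochasticIterate_eq_tupleIterate (φ : V → X → ℝ) (η : ℝ) (z : ℕ → X × ℝ)
    (v : ℕ → V) (n : ℕ) :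
    doublyStochasticIterate φ 0 (fun _ => η) z v (n + 1)
      = tupleIterate φ η n (fun i => (z (i + 1), v (i + 1))) := by
  induction n with
  | zero => rfl
  | succ n ih =>
    ext x
    have hi : Fin.init (fun i : Fin (n + 1) => (z (i + 1), v (i + 1)))
        = fun i : Fin n => (z (i + 1), v (i + 1)) := rfl
    rw [doublyStochasticIterate, ih, tupleIterate, featureStep, hi]
    simp

/-- The bound depends on the sample, since outputs are unbounded; it serves only to place the
iterates in `L²`. -/
lemma exists_bound_featureStep {φ : V → X → ℝ} {κ : ℝ} (hκ : ∀ v x, |φ v x| ≤ κ) (η : ℝ)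
    {f : X → ℝ} (hf : ∃ c, ∀ x, |f x| ≤ c) (p : (X × ℝ) × V) :
    ∃ c, ∀ x, |featureStep φ η f p x| ≤ c := by
  obtain ⟨c, hc⟩ := hf
  refine ⟨c + |η * (f p.1.1 - p.1.2) * φ p.2 p.1.1| * κ, fun x => ?_⟩
  refine (abs_sub _ _).trans ?_
  rw [abs_mul (η * (f p.1.1 - p.1.2) * φ p.2 p.1.1)]
  gcongr
  · exact hc x
  · exact hκ _ _

lemma exists_bound_tupleIterate {φ : V → X → ℝ} {κ : ℝ} (hκ : ∀ v x, |φ v x| ≤ κ) (η : ℝ)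
    (n : ℕ) (w : Fin n → (X × ℝ) × V) : ∃ c, ∀ x, |tupleIterate φ η n w x| ≤ c := by
  induction n with
  | zero => exact ⟨0, fun x => by simp [tupleIterate]⟩
  | succ n ih => exact exists_bound_featureStep hκ η (ih _) _

variable [MeasurableSpace X] [MeasurableSpace V]

lemma measurable_featureStep {W : Type*} [MeasurableSpace W] {φ : V → X → ℝ}
    (hφ : Measurable (Function.uncurry φ)) (η : ℝ) {F : W → X → ℝ}
    (hF : Measurable (Function.uncurry F)) :
    Measurable (fun q : (W × ((X × ℝ) × V)) × X => featureStep φ η (F q.1.1) q.1.2 q.2) := by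
  have h1 : Measurable (fun q : (W × ((X × ℝ) × V)) × X => F q.1.1 q.2) :=
    hF.comp (by fun_prop : Measurable fun q : (W × ((X × ℝ) × V)) × X => (q.1.1, q.2))
  have h2 : Measurable (fun q : (W × ((X × ℝ) × V)) × X => F q.1.1 q.1.2.1.1) :=
    hF.comp (by fun_prop : Measurable fun q : (W × ((X × ℝ) × V)) × X => (q.1.1, q.1.2.1.1))
  have h3 : Measurable (fun q : (W × ((X × ℝ) × V)) × X => φ q.1.2.2 q.1.2.1.1) :=
    hφ.comp (by fun_prop : Measurable fun q : (W × ((X × ℝ) × V)) × X => (q.1.2.2, q.1.2.1.1))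
  have h4 : Measurable (fun q : (W × ((X × ℝ) × V)) × X => φ q.1.2.2 q.2) :=
    hφ.comp (by fun_prop : Measurable fun q : (W × ((X × ℝ) × V)) × X => (q.1.2.2, q.2))
  unfold featureStep
  fun_prop

lemma measurable_tupleIterate {φ : V → X → ℝ} (hφ : Measurable (Function.uncurry φ)) (η : ℝ)
    (n : ℕ) : Measurable (Function.uncurry (tupleIterate φ η n)) := by
  induction n with
  | zero => exact measurable_const
  | succ n ih =>
    have hi : Measurable (fun w : Fin (n + 1) → (X × ℝ) × V => Fin.init w) :=
      measurable_pi_lambda _ fun i => measurable_pi_apply _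
    exact (measurable_featureStep hφ η ih).comp
      (((hi.comp measurable_fst).prodMk ((measurable_pi_apply (Fin.last n)).comp
        measurable_fst)).prodMk measurable_snd)

lemma memLp_tupleIterate {φ : V → X → ℝ} (hφ : Measurable (Function.uncurry φ)) {κ : ℝ}
    (hκ : ∀ v x, |φ v x| ≤ κ) (η : ℝ) (m : Measure X) [IsFiniteMeasure m] (n : ℕ)
    (w : Fin n → (X × ℝ) × V) : MemLp (tupleIterate φ η n w) 2 m := by
  obtain ⟨c, hc⟩ := exists_bound_tupleIterate hκ η n w
  exact MemLp.of_bound ((measurable_tupleIterate hφ η n).comp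
    measurable_prodMk_left).aestronglyMeasurable c (.of_forall hc)

variable (ν : Measure ((X × ℝ) × V)) [IsProbabilityMeasure ν]

/-- The last coordinate of an i.i.d. sequence is independent of the previous ones. -/
lemma measurePreserving_init_last (n : ℕ) :
    MeasurePreserving (fun w : Fin (n + 1) → (X × ℝ) × V => (Fin.init w, w (Fin.last n)))
      (Measure.pi fun _ => ν) ((Measure.pi fun _ => ν).prod ν) := by
  have h := measurePreserving_piFinSuccAbove (fun _ : Fin (n + 1) => ν) (Fin.last n)
  convert (Measure.measurePreserving_swap).comp h using 1
  funext w
  refine Prod.ext ?_ rfl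
  ext i <;> simp [MeasurableEquiv.piFinSuccAbove, Fin.init]

/-- Features that agree almost everywhere produce the same iterates almost surely. -/
lemma tupleIterate_congr_ae {m : Measure X} [IsProbabilityMeasure m] {φ ψ : V → X → ℝ}
    (hφ : Measurable (Function.uncurry φ)) (hψ : Measurable (Function.uncurry ψ))
    (hνm : ν.map (fun p => p.1.1) = m)
    (h1 : ∀ᵐ p ∂ν, φ p.2 p.1.1 = ψ p.2 p.1.1) (h2 : ∀ᵐ p ∂ν, ∀ᵐ x ∂m, φ p.2 x = ψ p.2 x)
    (η : ℝ) (n : ℕ) :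
    ∀ᵐ w ∂(Measure.pi fun _ : Fin n => ν), tupleIterate φ η n w =ᵐ[m] tupleIterate ψ η n w := by
  induction n with
  | zero => exact .of_forall fun w => .rfl
  | succ n ih =>
    have hmeas : MeasurableSet {q : (Fin n → (X × ℝ) × V) × ((X × ℝ) × V) |
        tupleIterate φ η n q.1 q.2.1.1 = tupleIterate ψ η n q.1 q.2.1.1} := by
      have hq : Measurable (fun q : (Fin n → (X × ℝ) × V) × ((X × ℝ) × V) => (q.1, q.2.1.1)) := by
        fun_prop
      exact measurableSet_eq_fun ((measurable_tupleIterate hφ η n).comp hq)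
        ((measurable_tupleIterate hψ η n).comp hq)
    have hx : ∀ᵐ q ∂((Measure.pi fun _ : Fin n => ν).prod ν),
        tupleIterate φ η n q.1 q.2.1.1 = tupleIterate ψ η n q.1 q.2.1.1 := by
      rw [Measure.ae_prod_iff_ae_ae hmeas]
      filter_upwards [ih] with w hw
      -- The fresh input has law `m` and is independent of the past, so it almost surely avoids the
      -- null set where the two iterates differ.
      rw [← hνm] at hw
      exact ae_of_ae_map (by fun_prop) hw
    have hq : ∀ᵐ q ∂((Measure.pi fun _ : Fin n => ν).prod ν),
        featureStep φ η (tupleIterate φ η n q.1) q.2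
          =ᵐ[m] featureStep ψ η (tupleIterate ψ η n q.1) q.2 := by
      filter_upwards [hx, Measure.quasiMeasurePreserving_fst.ae ih,
        Measure.quasiMeasurePreserving_snd.ae h1, Measure.quasiMeasurePreserving_snd.ae h2]
        with q hq hq1 hq2 hq3
      filter_upwards [hq1, hq3] with x hx1 hx2
      simp only [featureStep, hq, hx1, hx2, hq2]
    exact (measurePreserving_init_last ν n).quasiMeasurePreserving.ae hq

end Iterates

/-! ### Truncation of the features. -/

section Features

variable {X V : Type*} [MeasurableSpace X] [MeasurableSpace V]

/-- A one-sided bound on all products of values of a function bounds the function. -/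
lemma ae_abs_le_of_ae_mul_le {m : Measure X} {g : X → ℝ} {κ : ℝ} (hκ : 0 ≤ κ)
    (h : ∀ᵐ x ∂m, ∀ᵐ x' ∂m, g x * g x' ≤ κ ^ 2) : ∀ᵐ x ∂m, |g x| ≤ κ := by
  -- If `g > κ` on a non-null set, two points of that set have product above `κ²`. Applying this to
  -- `-g` as well gives the two-sided bound.
  have key (g : X → ℝ) (h : ∀ᵐ x ∂m, ∀ᵐ x' ∂m, g x * g x' ≤ κ ^ 2) : ∀ᵐ x ∂m, g x ≤ κ := by
    by_contra hcon
    have hfr : ∃ᶠ x in ae m, ¬ g x ≤ κ := Filter.not_eventually.1 hcon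
    obtain ⟨x, hx, hx'⟩ := (hfr.and_eventually h).exists
    obtain ⟨x', hy, hy'⟩ := (hfr.and_eventually hx').exists
    push Not at hx hy
    nlinarith
  filter_upwards [key g h, key (fun x => -g x) (by simpa using h)] with x h1 h2
  exact abs_le.2 ⟨by linarith, h1⟩

/-- Truncation of the features to `[-κ, κ]`. -/
noncomputable def clipFeature (φ : V → X → ℝ) (κ : ℝ) (v : V) (x : X) : ℝ :=
  max (-κ) (min κ (φ v x))

lemma measurable_clipFeature {φ : V → X → ℝ} (hφ : Measurable (Function.uncurry φ)) (κ : ℝ) :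
    Measurable (Function.uncurry (clipFeature φ κ)) :=
  measurable_const.max (measurable_const.min hφ)

omit [MeasurableSpace X] [MeasurableSpace V] in
lemma abs_clipFeature_le (φ : V → X → ℝ) {κ : ℝ} (hκ : 0 ≤ κ) (v : V) (x : X) :
    |clipFeature φ κ v x| ≤ κ :=
  abs_le.2 ⟨le_max_left _ _, max_le (by linarith) (min_le_left _ _)⟩

lemma clipFeature_ae_eq {m : Measure X} [SFinite m] {μ : Measure V} [SFinite μ]
    {φ : V → X → ℝ} {κ : ℝ} (hκ : 0 ≤ κ)
    (h : ∀ᵐ p ∂(μ.prod (m.prod m)), φ p.1 p.2.1 * φ p.1 p.2.2 ≤ κ ^ 2) :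
    ∀ᵐ v ∂μ, ∀ᵐ x ∂m, φ v x = clipFeature φ κ v x := by
  filter_upwards [Measure.ae_ae_of_ae_prod h] with v hv
  filter_upwards [ae_abs_le_of_ae_mul_le hκ (Measure.ae_ae_of_ae_prod hv)] with x hx
  obtain ⟨h1, h2⟩ := abs_le.1 hx
  rw [clipFeature, min_eq_right h2, max_eq_right h1]

end Features

/-! ### The RKHS inclusion in `L²` and its integral operator. -/

section Kernel

variable {X : Type*} [MeasurableSpace X] {K : X → X → ℝ}
  {H : Type*} [NormedAddCommGroup H] [InnerProductSpace ℝ H] [CompleteSpace H] [RKHS ℝ H X ℝ]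

omit [MeasurableSpace X] in
lemma kerFun_one_apply (hH : ∀ x x', RKHS.kernel H x x' 1 = K x x') (x x' : X) :
    RKHS.kerFun H x' (1 : ℝ) x = K x x' := by
  rw [RKHS.kerFun_apply, hH]

/-- The functions in a reproducing kernel Hilbert space with measurable kernel are measurable. -/
lemma RKHS.measurable_coe (hH : ∀ x x', RKHS.kernel H x x' 1 = K x x')
    (hK : Measurable (Function.uncurry K)) (f : H) : Measurable f := by
  -- Combinations of kernel sections are measurable and dense, and norm convergence in an RKHS
  -- implies pointwise convergence.
  have hspan : ∀ g ∈ Submodule.span ℝ {RKHS.kerFun H x v | (x : X) (v : ℝ)},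
      Measurable (g : H) := by
    intro g hg
    induction hg using Submodule.span_induction with
    | mem g hg =>
      obtain ⟨x', c, rfl⟩ := hg
      have : RKHS.kerFun H x' c = c • RKHS.kerFun H x' (1 : ℝ) := by
        rw [← map_smul, smul_eq_mul, mul_one]
      have h : (⇑(RKHS.kerFun H x' c) : X → ℝ) = fun x => c * K x x' := by
        ext x
        rw [this, RKHS.coe_smul, Pi.smul_apply, kerFun_one_apply hH, smul_eq_mul]
      rw [h]
      exact (hK.comp measurable_prodMk_right).const_mul c
    | zero => rw [RKHS.coe_zero]; exact measurable_const
    | add a b _ _ ha hb => rw [RKHS.coe_add]; exact ha.add hb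
    | smul c a _ ha => rw [RKHS.coe_smul]; exact ha.const_smul c
  have hf : f ∈ closure
      (Submodule.span ℝ {RKHS.kerFun H x v | (x : X) (v : ℝ)} : Set H) := by
    rw [← Submodule.topologicalClosure_coe, RKHS.kerFun_dense]
    trivial
  obtain ⟨u, hu, hlim⟩ := mem_closure_iff_seq_limit.1 hf
  refine measurable_of_tendsto_metrizable (f := fun n => ⇑(u n)) (fun n => hspan _ (hu n)) ?_
  exact tendsto_pi_nhds.2 fun x => ((RKHS.continuous_eval x).tendsto f).comp hlim

omit [MeasurableSpace X] in
lemma RKHS.abs_apply_le (hH : ∀ x x', RKHS.kernel H x x' 1 = K x x') {κ : ℝ} (hκ : 0 ≤ κ)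
    {x : X} (hx : K x x ≤ κ ^ 2) (f : H) : |f x| ≤ κ * ‖f‖ := by
  have h1 : ‖RKHS.kerFun H x (1 : ℝ)‖ ≤ κ := by
    rw [← sq_le_sq₀ (norm_nonneg _) hκ, ← real_inner_self_eq_norm_sq, RKHS.inner_kerFun,
      kerFun_one_apply hH]
    simpa using hx
  have h2 : f x = inner ℝ (RKHS.kerFun H x (1 : ℝ)) f := by simp
  rw [h2]
  exact (abs_real_inner_le_norm _ _).trans (by gcongr)

lemma RKHS.memLp_coe (hH : ∀ x x', RKHS.kernel H x x' 1 = K x x')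
    (hK : Measurable (Function.uncurry K)) {κ : ℝ} (hκ : 0 ≤ κ) {m : Measure X}
    [IsFiniteMeasure m] (hKκ : ∀ᵐ x ∂m, K x x ≤ κ ^ 2) (f : H) : MemLp f 2 m :=
  MemLp.of_bound (RKHS.measurable_coe hH hK f).aestronglyMeasurable (κ * ‖f‖)
    (hKκ.mono fun _ hx => RKHS.abs_apply_le hH hκ hx f)

/-- The inclusion of a reproducing kernel Hilbert space with bounded measurable kernel in `L²`. -/
lemma RKHS.exists_inclusion (hH : ∀ x x', RKHS.kernel H x x' 1 = K x x')
    (hK : Measurable (Function.uncurry K)) {κ : ℝ} (hκ : 0 ≤ κ) {m : Measure X}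
    [IsProbabilityMeasure m] (hKκ : ∀ᵐ x ∂m, K x x ≤ κ ^ 2) :
    ∃ J : H →L[ℝ] Lp ℝ 2 m, ‖J‖ ≤ κ ∧ ∀ f, ⇑(J f) =ᵐ[m] f := by
  have hm := RKHS.memLp_coe hH hK hκ hKκ
  let J₀ : H →ₗ[ℝ] Lp ℝ 2 m :=
    { toFun := fun f => (hm f).toLp
      map_add' := fun f g => by
        rw [← MemLp.toLp_add]
        exact MemLp.toLp_congr _ _ (by rw [RKHS.coe_add])
      map_smul' := fun c f => by
        rw [RingHom.id_apply, ← MemLp.toLp_const_smul]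
        exact MemLp.toLp_congr _ _ (by rw [RKHS.coe_smul]) }
  have hJ (f : H) : ‖J₀ f‖ ≤ κ * ‖f‖ := by
    have h := Lp.norm_le_of_ae_bound (p := 2) (f := J₀ f) (C := κ * ‖f‖) (by positivity) (by
      filter_upwards [(hm f).coeFn_toLp, hKκ] with x hx hx'
      change ‖(hm f).toLp _ x‖ ≤ _
      rw [hx]
      exact RKHS.abs_apply_le hH hκ hx' f)
    simpa [measureUnivNNReal] using h
  exact ⟨J₀.mkContinuous κ hJ, J₀.mkContinuous_norm_le hκ hJ, fun f => (hm f).coeFn_toLp⟩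

variable {V : Type*} [MeasurableSpace V] {μ : Measure V} [IsProbabilityMeasure μ]

/-- The adjoint of the inclusion is the integral operator of the kernel. -/
lemma RKHS.adjoint_inclusion_apply (hH : ∀ x x', RKHS.kernel H x x' 1 = K x x')
    {m : Measure X} {J : H →L[ℝ] Lp ℝ 2 m} (hJ : ∀ f, ⇑(J f) =ᵐ[m] f) (e : Lp ℝ 2 m) (x : X) :
    J.adjoint e x = ∫ x', e x' * K x' x ∂m := by
  have h2 : J.adjoint e x = inner ℝ (RKHS.kerFun H x (1 : ℝ)) (J.adjoint e) := by simp
  rw [h2, ContinuousLinearMap.adjoint_inner_right, L2.inner_def]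
  refine integral_congr_ae ?_
  filter_upwards [hJ (RKHS.kerFun H x (1 : ℝ))] with x' hx'
  rw [hx', kerFun_one_apply hH]
  simp [mul_comm]

/-- The integral operator of the kernel is an average over rank-one feature operators. -/
lemma RKHS.inner_inclusion_adjoint (hH : ∀ x x', RKHS.kernel H x x' 1 = K x x')
    {m : Measure X} [IsProbabilityMeasure m] {J : H →L[ℝ] Lp ℝ 2 m} (hJ : ∀ f, ⇑(J f) =ᵐ[m] f)
    {φ ψ : V → X → ℝ} (hφ : Measurable (Function.uncurry φ)) (hψ : Measurable (Function.uncurry ψ))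
    (hKφ : ∀ x x', K x x' = ∫ v, φ v x * φ v x' ∂μ) {κ : ℝ} (hκ : ∀ v x, |ψ v x| ≤ κ)
    (hφψ : ∀ᵐ v ∂μ, ∀ᵐ x ∂m, φ v x = ψ v x) (w e : Lp ℝ 2 m) :
    inner ℝ w (J (J.adjoint e)) = ∫ v, (∫ x, w x * ψ v x ∂m) * (∫ x, e x * ψ v x ∂m) ∂μ := by
  have hx : ∀ᵐ x ∂m, ∀ᵐ v ∂μ, φ v x = ψ v x :=
    (Measure.ae_ae_comm (p := fun v x => φ v x = ψ v x) (measurableSet_eq_fun hφ hψ)).1 hφψ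
  have hw1 : Integrable w m := (Lp.memLp w).integrable (by simp)
  have he1 : Integrable e m := (Lp.memLp e).integrable (by simp)
  have hint : Integrable (fun q : (X × X) × V => (w q.1.1 * e q.1.2) * (ψ q.2 q.1.1 * ψ q.2 q.1.2))
      ((m.prod m).prod μ) := by
    refine Integrable.mul_bdd (c := κ * κ) ((hw1.mul_prod he1).comp_fst μ) ?_ ?_
    · have h1 : Measurable (fun q : (X × X) × V => ψ q.2 q.1.1) :=
        hψ.comp (by fun_prop : Measurable fun q : (X × X) × V => (q.2, q.1.1))
      have h2 : Measurable (fun q : (X × X) × V => ψ q.2 q.1.2) :=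
        hψ.comp (by fun_prop : Measurable fun q : (X × X) × V => (q.2, q.1.2))
      exact (h1.mul h2).aestronglyMeasurable
    · refine .of_forall fun q => ?_
      rw [norm_mul]
      exact mul_le_mul (hκ _ _) (hκ _ _) (norm_nonneg _) ((abs_nonneg _).trans (hκ q.2 q.1.1))
  calc inner ℝ w (J (J.adjoint e))
      = ∫ x, ∫ x', ∫ v, (w x * e x') * (ψ v x * ψ v x') ∂μ ∂m ∂m := by
        rw [L2.inner_def]
        refine integral_congr_ae ?_
        filter_upwards [hJ (J.adjoint e), hx] with x h1 h2
        rw [h1, RKHS.adjoint_inclusion_apply hH hJ]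
        simp only [RCLike.inner_apply, conj_trivial]
        rw [mul_comm, ← integral_const_mul]
        refine integral_congr_ae ?_
        filter_upwards [hx] with x' h3
        rw [integral_const_mul, hKφ, mul_assoc]
        congr 2
        refine integral_congr_ae ?_
        filter_upwards [h2, h3] with v h4 h5
        rw [h4, h5, mul_comm]
    _ = ∫ q : X × X, ∫ v, (w q.1 * e q.2) * (ψ v q.1 * ψ v q.2) ∂μ ∂(m.prod m) :=
        (integral_prod (fun q : X × X => ∫ v, (w q.1 * e q.2) * (ψ v q.1 * ψ v q.2) ∂μ)
          hint.integral_prod_left).symm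
    _ = ∫ v, ∫ q : X × X, (w q.1 * e q.2) * (ψ v q.1 * ψ v q.2) ∂(m.prod m) ∂μ :=
        integral_integral_swap hint
    _ = _ := by
        refine integral_congr_ae (.of_forall fun v => ?_)
        change _ = (∫ x, w x * ψ v x ∂m) * (∫ x, e x * ψ v x ∂m)
        rw [← integral_prod_mul (fun x => w x * ψ v x) (fun x => e x * ψ v x)]
        refine integral_congr_ae (.of_forall fun q => ?_)
        ring

end Kernel

/-! ### Orthogonality of the regression residual. -/

section Regression

variable {X : Type*} [MeasurableSpace X] {ρ : Measure (X × ℝ)}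

lemma MeasureTheory.MemLp.integrable_fun_mul {m : Measure X} {f g : X → ℝ} (hf : MemLp f 2 m)
    (hg : MemLp g 2 m) : Integrable (fun x => f x * g x) m :=
  hf.integrable_mul hg

lemma MeasureTheory.MemLp.comp_fst_measure {f : X → ℝ} (hf : MemLp f 2 ρ.fst) :
    MemLp (fun p : X × ℝ => f p.1) 2 ρ :=
  hf.comp_measurePreserving ⟨measurable_fst, rfl⟩

lemma integral_comp_fst {f : X → ℝ} (hf : AEStronglyMeasurable f ρ.fst) :
    ∫ p, f p.1 ∂ρ = ∫ x, f x ∂ρ.fst :=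
  (integral_map measurable_fst.aemeasurable hf).symm

variable [IsProbabilityMeasure ρ]

/-- The regression function is the orthogonal projection of the output. -/
lemma integral_snd_mul_eq_integral_regressionFunction_mul
    (hy : MemLp (fun p : X × ℝ => p.2) 2 ρ) {h : X → ℝ} (hh : MemLp h 2 ρ.fst) :
    ∫ p, p.2 * h p.1 ∂ρ = ∫ x, regressionFunction ρ x * h x ∂ρ.fst := by
  rw [← Measure.integral_condKernel (hy.integrable_fun_mul hh.comp_fst_measure)]
  simp_rw [integral_mul_const]
  rfl

variable {f : X → ℝ} (hy : MemLp (fun p : X × ℝ => p.2) 2 ρ)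
  (hρ : MemLp (regressionFunction ρ) 2 ρ.fst) (hf : MemLp f 2 ρ.fst)
include hy hρ hf

lemma integral_residual_mul {h : X → ℝ} (hh : MemLp h 2 ρ.fst) :
    ∫ p, (f p.1 - p.2) * h p.1 ∂ρ = ∫ x, (f x - regressionFunction ρ x) * h x ∂ρ.fst := by
  simp_rw [sub_mul]
  rw [integral_sub (hf.comp_fst_measure.integrable_fun_mul hh.comp_fst_measure)
    (hy.integrable_fun_mul hh.comp_fst_measure),
    integral_sub (hf.integrable_fun_mul hh) (hρ.integrable_fun_mul hh),
    integral_snd_mul_eq_integral_regressionFunction_mul hy hh,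
    integral_comp_fst (f := fun x => f x * h x) (hf.1.mul hh.1)]

/-- Decomposition of the risk in approximation error and noise. -/
lemma integral_residual_sq :
    ∫ p, (f p.1 - p.2) ^ 2 ∂ρ
      = ∫ x, (f x - regressionFunction ρ x) ^ 2 ∂ρ.fst + expectedRisk ρ (regressionFunction ρ) := by
  have hd : MemLp (fun x => f x - regressionFunction ρ x) 2 ρ.fst := hf.sub hρ
  have hn : MemLp (fun p : X × ℝ => regressionFunction ρ p.1 - p.2) 2 ρ :=
    hρ.comp_fst_measure.sub hy
  have h1 : ∀ p : X × ℝ, (f p.1 - p.2) ^ 2 = (f p.1 - regressionFunction ρ p.1) ^ 2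
      + ((regressionFunction ρ p.1 - p.2) ^ 2
        + 2 * ((regressionFunction ρ p.1 - p.2) * (f p.1 - regressionFunction ρ p.1))) := by
    intro p; ring
  have i1 : Integrable (fun p : X × ℝ => (f p.1 - regressionFunction ρ p.1) ^ 2) ρ :=
    hd.comp_fst_measure.integrable_sq
  have i2 : Integrable (fun p : X × ℝ => (regressionFunction ρ p.1 - p.2) ^ 2) ρ :=
    hn.integrable_sq
  have i3 : Integrable (fun p : X × ℝ => 2 * ((regressionFunction ρ p.1 - p.2)
      * (f p.1 - regressionFunction ρ p.1))) ρ :=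
    (hn.integrable_fun_mul hd.comp_fst_measure).const_mul 2
  have i23 : Integrable (fun p : X × ℝ => (regressionFunction ρ p.1 - p.2) ^ 2
      + 2 * ((regressionFunction ρ p.1 - p.2) * (f p.1 - regressionFunction ρ p.1))) ρ := i2.add i3
  simp_rw [h1]
  rw [integral_add i1 i23, integral_add i2 i3, integral_const_mul,
    integral_residual_mul hy hρ hρ hd,
    integral_comp_fst (f := fun x => (f x - regressionFunction ρ x) ^ 2) hd.integrable_sq.1]
  simp [expectedRisk]

end Regression

/-! ### Expected error after one stochastic step. -/

section OneStep

variable {X V : Type*} [MeasurableSpace X] [MeasurableSpace V] {ρ : Measure (X × ℝ)}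
  [IsProbabilityMeasure ρ] {μ : Measure V} [IsProbabilityMeasure μ]
  {H : Type*} [NormedAddCommGroup H] [InnerProductSpace ℝ H] [CompleteSpace H]

lemma norm_sq_eq_integral_sq {m : Measure X} (e : Lp ℝ 2 m) : ‖e‖ ^ 2 = ∫ x, e x ^ 2 ∂m := by
  rw [← real_inner_self_eq_norm_sq, L2.inner_def]
  simp [sq]

/-- Expected effect of one step of doubly stochastic gradient descent on the error, measured after
`s` further deterministic steps. -/
lemma lintegral_featureStep_le (hy : MemLp (fun p : X × ℝ => p.2) 2 ρ) {ψ : V → X → ℝ}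
    (hψ : Measurable (Function.uncurry ψ)) {κ : ℝ} (hκ : ∀ v x, |ψ v x| ≤ κ)
    {J : H →L[ℝ] Lp ℝ 2 ρ.fst}
    (hJ : ∀ w e : Lp ℝ 2 ρ.fst, inner ℝ w (J (J.adjoint e))
      = ∫ v, (∫ x, w x * ψ v x ∂ρ.fst) * (∫ x, e x * ψ v x ∂ρ.fst) ∂μ)
    {g : Lp ℝ 2 ρ.fst} (hg : g =ᵐ[ρ.fst] regressionFunction ρ)
    {η : ℝ} (hη : 0 ≤ η) (hη1 : η * ‖J‖ ^ 2 ≤ 1)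
    {f : X → ℝ} (hf : MemLp f 2 ρ.fst) (hstep : ∀ p, MemLp (featureStep ψ η f p) 2 ρ.fst) (s : ℕ) :
    ∫⁻ p, ENNReal.ofReal (‖(gradientContraction J η ^ s) ((hstep p).toLp - g)‖ ^ 2) ∂(ρ.prod μ)
      ≤ ENNReal.ofReal (‖(gradientContraction J η ^ (s + 1)) (hf.toLp - g)‖ ^ 2)
        + ENNReal.ofReal (η ^ 2 * κ ^ 4)
          * (ENNReal.ofReal (‖hf.toLp - g‖ ^ 2)
            + ENNReal.ofReal (expectedRisk ρ (regressionFunction ρ))) := by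
  have hρ : MemLp (regressionFunction ρ) 2 ρ.fst := (memLp_congr_ae hg).1 (Lp.memLp g)
  have hψm (v : V) : Measurable (ψ v) := hψ.comp measurable_prodMk_left
  have hψ2 (v : V) : MemLp (ψ v) 2 ρ.fst :=
    MemLp.of_bound (hψm v).aestronglyMeasurable κ (.of_forall (hκ v))
  set A := gradientContraction J η with hA
  set e : Lp ℝ 2 ρ.fst := hf.toLp - g with he
  have hee : ⇑e =ᵐ[ρ.fst] fun x => f x - regressionFunction ρ x := by
    filter_upwards [Lp.coeFn_sub (hf.toLp) g, hf.coeFn_toLp, hg] with x h1 h2 h3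
    rw [he, h1, Pi.sub_apply, h2, h3]
  -- By self-adjointness `⟨A^s e, A^s ψ_v⟩ = ⟨A^(2s) e, ψ_v⟩ = Q v`, which depends on `v` alone.
  set w : Lp ℝ 2 ρ.fst := (A ^ s) ((A ^ s) e) with hw
  let Q : V → ℝ := fun v => ∫ x, w x * ψ v x ∂ρ.fst
  have hQm : Measurable Q := by
    refine StronglyMeasurable.measurable ?_
    refine StronglyMeasurable.integral_prod_right'
      (f := fun p : V × X => w p.2 * ψ p.1 p.2) (Measurable.stronglyMeasurable ?_)
    exact ((Lp.stronglyMeasurable w).measurable.comp measurable_snd).mul hψ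
  have hw1 : Integrable w ρ.fst := (Lp.memLp w).integrable (by simp)
  have hQb (v : V) : |Q v| ≤ (∫ x, |w x| ∂ρ.fst) * κ := by
    rw [← integral_mul_const]
    refine abs_integral_le_integral_abs.trans (integral_mono_of_nonneg
      (.of_forall fun _ => abs_nonneg _) (hw1.abs.mul_const κ) (.of_forall fun x => ?_))
    simp only [abs_mul]
    gcongr
    exact hκ v x
  have hr2 : MemLp (fun p : X × ℝ => f p.1 - p.2) 2 ρ := hf.comp_fst_measure.sub hy
  have hr1 : Integrable (fun p : X × ℝ => f p.1 - p.2) ρ := hr2.integrable (by simp)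
  have hint1 : Integrable (fun p : (X × ℝ) × V => (f p.1.1 - p.1.2) * (ψ p.2 p.1.1 * Q p.2))
      (ρ.prod μ) := by
    refine Integrable.mul_bdd (c := κ * ((∫ x, |w x| ∂ρ.fst) * κ)) (hr1.comp_fst μ) ?_ ?_
    · have h1 : Measurable (fun q : (X × ℝ) × V => ψ q.2 q.1.1) :=
        hψ.comp (by fun_prop : Measurable fun q : (X × ℝ) × V => (q.2, q.1.1))
      exact (h1.mul (hQm.comp measurable_snd)).aestronglyMeasurable
    · refine .of_forall fun p => ?_
      rw [norm_mul]
      exact mul_le_mul (hκ _ _) (hQb _) (norm_nonneg _) ((abs_nonneg _).trans (hκ p.2 p.1.1))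
  have hint2 : Integrable (fun p : (X × ℝ) × V => (f p.1.1 - p.1.2) ^ 2) (ρ.prod μ) :=
    hr2.integrable_sq.comp_fst μ
  let B : (X × ℝ) × V → ℝ := fun p => ‖(A ^ s) e‖ ^ 2
    - 2 * η * ((f p.1.1 - p.1.2) * (ψ p.2 p.1.1 * Q p.2)) + η ^ 2 * κ ^ 4 * (f p.1.1 - p.1.2) ^ 2
  have hBint : Integrable B (ρ.prod μ) :=
    ((integrable_const _).sub (hint1.const_mul (2 * η))).add (hint2.const_mul (η ^ 2 * κ ^ 4))
  -- Expansion of the square; each of the two factors `ψ` in the update contributes `κ²` to the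
  -- quadratic term.
  have hpt (p : (X × ℝ) × V) : ‖(A ^ s) ((hstep p).toLp - g)‖ ^ 2 ≤ B p := by
    set c := (f p.1.1 - p.1.2) * ψ p.2 p.1.1 with hc
    have h1 : (hstep p).toLp - g = e - (η * c) • (hψ2 p.2).toLp := by
      have : (hstep p).toLp = hf.toLp - (η * c) • (hψ2 p.2).toLp := by
        rw [← MemLp.toLp_const_smul, ← MemLp.toLp_sub]
        refine MemLp.toLp_congr _ _ (.of_forall fun x => ?_)
        simp only [featureStep, Pi.sub_apply, Pi.smul_apply, smul_eq_mul, hc]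
        ring
      rw [this, he]
      abel
    have h2 : inner ℝ ((A ^ s) e) ((A ^ s) ((hψ2 p.2).toLp)) = Q p.2 := by
      rw [← inner_gradientContraction_pow, ← hA, ← hw, L2.inner_def]
      refine integral_congr_ae ?_
      filter_upwards [(hψ2 p.2).coeFn_toLp] with x hx
      rw [hx]
      simp [mul_comm]
    have h3 : ‖(A ^ s) ((hψ2 p.2).toLp)‖ ≤ κ := by
      refine (norm_gradientContraction_pow_le J hη hη1 s _).trans ?_
      have h := Lp.norm_le_of_ae_bound (p := 2) (f := (hψ2 p.2).toLp) (C := κ)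
        ((abs_nonneg _).trans (hκ p.2 p.1.1)) (by
          filter_upwards [(hψ2 p.2).coeFn_toLp] with x hx
          rw [hx]
          exact hκ _ _)
      simpa [measureUnivNNReal] using h
    have h4 : c ^ 2 ≤ (f p.1.1 - p.1.2) ^ 2 * κ ^ 2 := by
      rw [hc, mul_pow]
      gcongr 1
      exact sq_le_sq.2 ((hκ _ _).trans (le_abs_self κ))
    have h5 : (η * c) ^ 2 * ‖(A ^ s) ((hψ2 p.2).toLp)‖ ^ 2
        ≤ η ^ 2 * κ ^ 4 * (f p.1.1 - p.1.2) ^ 2 := by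
      calc (η * c) ^ 2 * ‖(A ^ s) ((hψ2 p.2).toLp)‖ ^ 2
          = η ^ 2 * (c ^ 2 * ‖(A ^ s) ((hψ2 p.2).toLp)‖ ^ 2) := by ring
        _ ≤ η ^ 2 * (((f p.1.1 - p.1.2) ^ 2 * κ ^ 2) * κ ^ 2) := by gcongr
        _ = _ := by ring
    rw [h1, map_sub, map_smul, norm_sub_sq_real, real_inner_smul_right, h2, norm_smul, mul_pow,
      Real.norm_eq_abs, sq_abs]
    simp only [B]
    have h6 : 2 * (η * c * Q p.2) = 2 * η * ((f p.1.1 - p.1.2) * (ψ p.2 p.1.1 * Q p.2)) := by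
      rw [hc]; ring
    linarith
  have hcross : ∫ p, (f p.1.1 - p.1.2) * (ψ p.2 p.1.1 * Q p.2) ∂(ρ.prod μ)
      = inner ℝ w (J (J.adjoint e)) := by
    -- With `v` fixed, averaging over the data first replaces `f(x) - y` by the error `e`.
    rw [integral_prod_symm _ hint1, hJ]
    refine integral_congr_ae (.of_forall fun v => ?_)
    change ∫ p, (f p.1 - p.2) * (ψ v p.1 * Q v) ∂ρ = Q v * _
    simp_rw [← mul_assoc]
    rw [integral_mul_const, mul_comm, integral_residual_mul hy hρ hf (hψ2 v)]
    congr 1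
    refine integral_congr_ae ?_
    filter_upwards [hee] with x hx
    rw [hx]
  have hsq : ∫ p, (f p.1.1 - p.1.2) ^ 2 ∂(ρ.prod μ)
      = ‖e‖ ^ 2 + expectedRisk ρ (regressionFunction ρ) := by
    rw [integral_prod _ hint2]
    simp only [integral_const, probReal_univ, one_smul]
    rw [integral_residual_sq hy hρ hf, norm_sq_eq_integral_sq]
    congr 1
    refine integral_congr_ae ?_
    filter_upwards [hee] with x hx
    rw [hx]
  have hB : ∫ p, B p ∂(ρ.prod μ) = ‖(A ^ s) e‖ ^ 2 - 2 * η * inner ℝ w (J (J.adjoint e))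
      + η ^ 2 * κ ^ 4 * (‖e‖ ^ 2 + expectedRisk ρ (regressionFunction ρ)) := by
    have hint3 : Integrable (fun p : (X × ℝ) × V => ‖(A ^ s) e‖ ^ 2
        - 2 * η * ((f p.1.1 - p.1.2) * (ψ p.2 p.1.1 * Q p.2))) (ρ.prod μ) :=
      (integrable_const _).sub (hint1.const_mul (2 * η))
    simp only [B]
    rw [integral_add hint3 (hint2.const_mul (η ^ 2 * κ ^ 4)), integral_sub (integrable_const _)
      (hint1.const_mul (2 * η)), integral_const_mul, integral_const_mul, hcross, hsq]
    simp
  -- The left side is `‖A^(s+1) e‖²` without its nonnegative term `‖η A^s J J† e‖²`.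
  have hsucc : ‖(A ^ s) e‖ ^ 2 - 2 * η * inner ℝ w (J (J.adjoint e)) ≤ ‖(A ^ (s + 1)) e‖ ^ 2 := by
    rw [pow_succ A s, mul_apply_eq_comp, hA, gradientContraction_apply, ← hA, map_sub (A ^ s) e, map_smul,
      norm_sub_sq_real, real_inner_smul_right, ← inner_gradientContraction_pow, ← hA, ← hw]
    nlinarith [sq_nonneg ‖η • (A ^ s) (J (J.adjoint e))‖]
  have hrisk : 0 ≤ expectedRisk ρ (regressionFunction ρ) :=
    integral_nonneg fun _ => sq_nonneg _
  calc ∫⁻ p, ENNReal.ofReal (‖(A ^ s) ((hstep p).toLp - g)‖ ^ 2) ∂(ρ.prod μ)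
      ≤ ∫⁻ p, ENNReal.ofReal (B p) ∂(ρ.prod μ) :=
        lintegral_mono fun p => ENNReal.ofReal_le_ofReal (hpt p)
    _ = ENNReal.ofReal (∫ p, B p ∂(ρ.prod μ)) :=
        (ofReal_integral_eq_lintegral_ofReal hBint
          (.of_forall fun p => (sq_nonneg _).trans (hpt p))).symm
    _ ≤ ENNReal.ofReal (‖(A ^ (s + 1)) e‖ ^ 2
          + η ^ 2 * κ ^ 4 * (‖e‖ ^ 2 + expectedRisk ρ (regressionFunction ρ))) := by
        rw [hB]
        gcongr
    _ = _ := by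
        rw [ENNReal.ofReal_add (sq_nonneg _) (by positivity), ENNReal.ofReal_mul (by positivity),
          ENNReal.ofReal_add (sq_nonneg _) hrisk]

end OneStep

/-! ### Bias-variance recursion along the iterates. -/

section Convergence

variable {X V : Type*} [MeasurableSpace X] [MeasurableSpace.CountablyGenerated X]
  [MeasurableSpace V] {ρ : Measure (X × ℝ)}
  [IsProbabilityMeasure ρ] {μ : Measure V} [IsProbabilityMeasure μ]
  {H : Type*} [NormedAddCommGroup H] [InnerProductSpace ℝ H] [CompleteSpace H]

lemma measurable_norm_pow_tupleIterate {m : Measure X} [IsFiniteMeasure m] {ψ : V → X → ℝ}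
    (hψ : Measurable (Function.uncurry ψ)) {κ : ℝ} (hκ : ∀ v x, |ψ v x| ≤ κ) (η : ℝ)
    (A : Lp ℝ 2 m →L[ℝ] Lp ℝ 2 m) (g : Lp ℝ 2 m) (n : ℕ) :
    Measurable fun w => ENNReal.ofReal
      (‖A ((memLp_tupleIterate hψ hκ η m n w).toLp - g)‖ ^ 2) :=
  ENNReal.measurable_ofReal.comp (measurable_continuous_comp_toLp
    (measurable_tupleIterate hψ η n) (memLp_tupleIterate hψ hκ η m n)
    (G := fun u => ‖A (u - g)‖ ^ 2)
    ((A.continuous.comp (continuous_id.sub continuous_const)).norm.pow 2))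

omit [MeasurableSpace.CountablyGenerated X] in
/-- Integration of a conditional bound on the last coordinate of an i.i.d. sequence. -/
lemma lintegral_init_last_le (ν : Measure ((X × ℝ) × V)) [IsProbabilityMeasure ν] (n : ℕ)
    {F : (Fin n → (X × ℝ) × V) × ((X × ℝ) × V) → ENNReal} (hF : Measurable F)
    {a b : (Fin n → (X × ℝ) × V) → ENNReal} (ha : Measurable a) (hb : Measurable b) {c d : ENNReal}
    (h : ∀ w, ∫⁻ p, F (w, p) ∂ν ≤ a w + c * (b w + d)) :
    ∫⁻ w, F (Fin.init w, w (Fin.last n)) ∂(Measure.pi fun _ => ν)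
      ≤ ∫⁻ w, a w ∂(Measure.pi fun _ => ν) + c * (∫⁻ w, b w ∂(Measure.pi fun _ => ν) + d) := by
  rw [(measurePreserving_init_last ν n).lintegral_comp hF, lintegral_prod _ hF.aemeasurable]
  refine (lintegral_mono h).trans_eq ?_
  rw [lintegral_add_left ha, lintegral_const_mul _ (hb.add_const _), lintegral_add_left hb,
    lintegral_const]
  simp

/-- Recursion for the expected error after `n` stochastic and `s` deterministic steps. -/
lemma lintegral_tupleIterate_succ_le (hy : MemLp (fun p : X × ℝ => p.2) 2 ρ) {ψ : V → X → ℝ}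
    (hψ : Measurable (Function.uncurry ψ)) {κ : ℝ} (hκ : ∀ v x, |ψ v x| ≤ κ)
    {J : H →L[ℝ] Lp ℝ 2 ρ.fst}
    (hJ : ∀ w e : Lp ℝ 2 ρ.fst, inner ℝ w (J (J.adjoint e))
      = ∫ v, (∫ x, w x * ψ v x ∂ρ.fst) * (∫ x, e x * ψ v x ∂ρ.fst) ∂μ)
    {g : Lp ℝ 2 ρ.fst} (hg : g =ᵐ[ρ.fst] regressionFunction ρ)
    {η : ℝ} (hη : 0 ≤ η) (hη1 : η * ‖J‖ ^ 2 ≤ 1) (n s : ℕ) :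
    ∫⁻ w, ENNReal.ofReal (‖(gradientContraction J η ^ s)
        ((memLp_tupleIterate hψ hκ η ρ.fst (n + 1) w).toLp - g)‖ ^ 2)
          ∂(Measure.pi fun _ => ρ.prod μ)
      ≤ ∫⁻ w, ENNReal.ofReal (‖(gradientContraction J η ^ (s + 1))
          ((memLp_tupleIterate hψ hκ η ρ.fst n w).toLp - g)‖ ^ 2)
            ∂(Measure.pi fun _ => ρ.prod μ)
        + ENNReal.ofReal (η ^ 2 * κ ^ 4)
          * (∫⁻ w, ENNReal.ofReal
              (‖(memLp_tupleIterate hψ hκ η ρ.fst n w).toLp - g‖ ^ 2)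
                ∂(Measure.pi fun _ => ρ.prod μ)
            + ENNReal.ofReal (expectedRisk ρ (regressionFunction ρ))) := by
  have hstep (q : (Fin n → (X × ℝ) × V) × ((X × ℝ) × V)) :
      MemLp (featureStep ψ η (tupleIterate ψ η n q.1) q.2) 2 ρ.fst := by
    obtain ⟨c, hc⟩ := exists_bound_featureStep hκ η (exists_bound_tupleIterate hκ η n q.1) q.2
    exact MemLp.of_bound ((measurable_featureStep hψ η (measurable_tupleIterate hψ η n)).comp
      (measurable_prodMk_left (x := q))).aestronglyMeasurable c (.of_forall hc)
  have hmeas : Measurable fun q => ENNReal.ofReal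
      (‖(gradientContraction J η ^ s) ((hstep q).toLp - g)‖ ^ 2) :=
    ENNReal.measurable_ofReal.comp (measurable_continuous_comp_toLp
      (measurable_featureStep hψ η (measurable_tupleIterate hψ η n)) hstep
      (G := fun u => ‖(gradientContraction J η ^ s) (u - g)‖ ^ 2)
      (((gradientContraction J η ^ s).continuous.comp
        (continuous_id.sub continuous_const)).norm.pow 2))
  have hm0 := measurable_norm_pow_tupleIterate hψ hκ η (.id ℝ (Lp ℝ 2 ρ.fst)) g n
  have hm1 := measurable_norm_pow_tupleIterate hψ hκ η (gradientContraction J η ^ (s + 1)) g n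
  exact lintegral_init_last_le (ρ.prod μ) n hmeas hm1 hm0 fun w =>
    lintegral_featureStep_le hy hψ hκ hJ hg hη hη1
      (memLp_tupleIterate hψ hκ η ρ.fst n w) (fun p => hstep (w, p)) s

/-- Bias-variance bound for doubly stochastic gradient descent with a constant step size. -/
lemma lintegral_tupleIterate_le (hy : MemLp (fun p : X × ℝ => p.2) 2 ρ) {ψ : V → X → ℝ}
    (hψ : Measurable (Function.uncurry ψ)) {κ : ℝ} (hκ : ∀ v x, |ψ v x| ≤ κ)
    {J : H →L[ℝ] Lp ℝ 2 ρ.fst}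
    (hJ : ∀ w e : Lp ℝ 2 ρ.fst, inner ℝ w (J (J.adjoint e))
      = ∫ v, (∫ x, w x * ψ v x ∂ρ.fst) * (∫ x, e x * ψ v x ∂ρ.fst) ∂μ)
    {g : Lp ℝ 2 ρ.fst} (hg : g =ᵐ[ρ.fst] regressionFunction ρ)
    {η : ℝ} (hη : 0 ≤ η) (hη1 : η * ‖J‖ ^ 2 ≤ 1) (n s : ℕ)
    (hn : n * (η ^ 2 * κ ^ 4) ≤ 1 / 4) :
    ∫⁻ w, ENNReal.ofReal (‖(gradientContraction J η ^ s)
        ((memLp_tupleIterate hψ hκ η ρ.fst n w).toLp - g)‖ ^ 2)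
          ∂(Measure.pi fun _ => ρ.prod μ)
      ≤ ENNReal.ofReal (‖(gradientContraction J η ^ (n + s)) g‖ ^ 2
        + n * (η ^ 2 * κ ^ 4)
          * (2 * ‖g‖ ^ 2 + 3 * expectedRisk ρ (regressionFunction ρ))) := by
  have hrisk : 0 ≤ expectedRisk ρ (regressionFunction ρ) := integral_nonneg fun _ => sq_nonneg _
  set σ := expectedRisk ρ (regressionFunction ρ)
  have hb : 0 ≤ η ^ 2 * κ ^ 4 := by positivity
  set b := η ^ 2 * κ ^ 4
  -- Removing one stochastic step adds a deterministic one, so `s` must vary; the case `s = 0` also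
  -- controls the error feeding the noise term.
  induction n generalizing s with
  | zero =>
    have h0 (w : Fin 0 → (X × ℝ) × V) : (memLp_tupleIterate hψ hκ η ρ.fst 0 w).toLp = 0 :=
      MemLp.toLp_zero _
    simp [h0]
  | succ n ih =>
    have hn' : n * b ≤ 1 / 4 := by push_cast at hn; linarith
    refine (lintegral_tupleIterate_succ_le hy hψ hκ hJ hg hη hη1 n s).trans ?_
    have h2 : ‖(gradientContraction J η ^ (n + 0)) g‖ ^ 2 ≤ ‖g‖ ^ 2 := by
      gcongr
      exact norm_gradientContraction_pow_le J hη hη1 _ _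
    -- Since `n b ≤ 1/4`, the left side is at most `(3/2)‖g‖² + (7/4)σ`; the constants 2 and 3 leave
    -- room to close the induction.
    have h3 : ‖(gradientContraction J η ^ (n + 0)) g‖ ^ 2 + n * b * (2 * ‖g‖ ^ 2 + 3 * σ) + σ
        ≤ 2 * ‖g‖ ^ 2 + 3 * σ := by
      have : n * b * (2 * ‖g‖ ^ 2 + 3 * σ) ≤ 1 / 4 * (2 * ‖g‖ ^ 2 + 3 * σ) := by gcongr
      nlinarith [sq_nonneg ‖g‖]
    have ih0 := ih 0 hn'
    simp only [pow_zero, one_apply_eq_self] at ih0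
    grw [ih (s + 1) hn', ih0]
    rw [← ENNReal.ofReal_add (by positivity) hrisk, ← ENNReal.ofReal_mul hb,
      ← ENNReal.ofReal_add (by positivity) (by positivity)]
    refine ENNReal.ofReal_le_ofReal ?_
    have h4 := mul_le_mul_of_nonneg_left h3 hb
    rw [show n + 1 + s = n + (s + 1) by ring]
    rw [Nat.cast_succ]
    linarith

omit [MeasurableSpace.CountablyGenerated X] in
lemma eLpNorm_sub_sq_eq_ofReal {m : Measure X} {f r : X → ℝ} (hf : MemLp f 2 m)
    {g : Lp ℝ 2 m} (hg : g =ᵐ[m] r) :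
    eLpNorm (fun x => f x - r x) 2 m ^ 2 = ENNReal.ofReal (‖hf.toLp - g‖ ^ 2) := by
  rw [ENNReal.ofReal_pow (norm_nonneg _), ofReal_norm, Lp.enorm_def]
  congr 1
  refine eLpNorm_congr_ae ?_
  filter_upwards [Lp.coeFn_sub (hf.toLp) g, hf.coeFn_toLp, hg] with x h1 h2 h3
  rw [h1, Pi.sub_apply, h2, h3]

end Convergence

/-! ### Law of the samples, choice of step size and conclusion. -/

lemma map_shift_eq_pi {Ω Z : Type*} [MeasurableSpace Ω] [MeasurableSpace Z] {P : Measure Ω}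
    [IsProbabilityMeasure P] {ν : Measure Z} {T : ℕ} {Y : ℕ → Ω → Z}
    (hlaw : ∀ t ∈ Finset.Icc 1 T, HasLaw (Y t) ν P)
    (hindep : iIndepFun (fun (t : Finset.Icc 1 T) ω => Y t ω) P) :
    AEMeasurable (fun ω (i : Fin T) => Y (i + 1) ω) P ∧
      P.map (fun ω (i : Fin T) => Y (i + 1) ω) = Measure.pi fun _ => ν := by
  have hmem (i : Fin T) : (i : ℕ) + 1 ∈ Finset.Icc 1 T := Finset.mem_Icc.2 ⟨by omega, by omega⟩
  have hae (i : Fin T) : AEMeasurable (Y (i + 1)) P := (hlaw _ (hmem i)).aemeasurable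
  refine ⟨aemeasurable_pi_lambda _ hae, ?_⟩
  have hinj : Function.Injective fun i : Fin T => (⟨i + 1, hmem i⟩ : Finset.Icc 1 T) := by
    intro i j hij
    simpa [Fin.ext_iff] using hij
  have h := (iIndepFun_iff_map_fun_eq_pi_map hae).1 (hindep.precomp hinj)
  rw [h]
  congr 1
  ext1 i
  exact (hlaw _ (hmem i)).map_eq

/-- With `t = T^(1/3)`, `1 / (ηT) = 24κ⁴/t` and `T η²κ⁴ = 1/(576κ⁴t)`, so bias and variance are both
of order `1/t`. -/
lemma lastIterate_bound_le {κ R N a σ T : ℝ} (hκ : 1 ≤ κ) (hN : 0 ≤ N) (hR : N ≤ R) (hσ : 0 ≤ σ)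
    (hT : 2 ≤ T) {η b : ℝ} (hη : η = 1 / (24 * κ ^ 4 * (T ^ 2) ^ (1 / 3 : ℝ)))
    (hb : η * T * b ≤ N ^ 2) :
    0 < η ∧ η * κ ^ 2 ≤ 1 ∧ T * (η ^ 2 * κ ^ 4) ≤ 1 / 4 ∧
      b + T * (η ^ 2 * κ ^ 4) * (2 * a ^ 2 + 3 * σ)
        ≤ (24 * κ ^ 4 * R ^ 2 + 2 * a ^ 2 + 3 * σ) / Real.log 2
          * (T ^ (-(1 / 3) : ℝ) * Real.log T) := by
  have hT0 : 0 < T := by linarith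
  obtain ⟨t, ht⟩ : ∃ t, t = T ^ (1 / 3 : ℝ) := ⟨_, rfl⟩
  have ht1 : 1 ≤ t := ht ▸ Real.one_le_rpow (by linarith) (by norm_num)
  have ht0 : 0 < t := by linarith
  have hκ0 : 0 < κ := by linarith
  have h2 : (T ^ 2) ^ (1 / 3 : ℝ) = t ^ 2 := by
    rw [ht, ← Real.rpow_natCast, ← Real.rpow_natCast, ← Real.rpow_mul hT0.le,
      ← Real.rpow_mul hT0.le, mul_comm]
  have h3 : T = t ^ 3 := by
    rw [ht, ← Real.rpow_natCast, ← Real.rpow_mul hT0.le]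
    norm_num
  have h4 : T ^ (-(1 / 3) : ℝ) = t⁻¹ := by rw [ht, Real.rpow_neg hT0.le]
  rw [h2] at hη
  have hκ2 : 1 ≤ κ ^ 2 := one_le_pow₀ hκ
  have hκ4 : 1 ≤ κ ^ 4 := one_le_pow₀ hκ
  have hη0 : 0 < η := by rw [hη]; positivity
  have h5 : T * (η ^ 2 * κ ^ 4) = 1 / (576 * κ ^ 4) * t⁻¹ := by
    rw [hη, h3]; field_simp; norm_num
  have h6 : 1 / (576 * κ ^ 4) ≤ 1 / 4 := by
    apply one_div_le_one_div_of_le <;> linarith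
  have h7 : t⁻¹ ≤ 1 := inv_le_one_of_one_le₀ ht1
  have hlog2 : 0 < Real.log 2 := Real.log_pos (by norm_num)
  -- The logarithm enters only here, as a factor at least 1; this is the origin of `log 2` in the
  -- constant.
  have hlog : 1 ≤ Real.log T / Real.log 2 :=
    (one_le_div hlog2).2 (Real.log_le_log (by norm_num) hT)
  refine ⟨hη0, ?_, ?_, ?_⟩
  · rw [hη, div_mul_eq_mul_div, one_mul, div_le_one (by positivity)]
    have : 1 ≤ t ^ 2 := one_le_pow₀ ht1
    have h8 : κ ^ 2 * 1 ≤ κ ^ 2 * κ ^ 2 := by gcongr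
    have h9 : κ ^ 4 * 1 ≤ κ ^ 4 * t ^ 2 := by gcongr
    nlinarith
  · rw [h5]
    calc 1 / (576 * κ ^ 4) * t⁻¹ ≤ 1 / 4 * 1 := by gcongr
      _ = 1 / 4 := mul_one _
  · have hηT : η * T = t / (24 * κ ^ 4) := by rw [hη, h3]; field_simp
    have hbias : b ≤ 24 * κ ^ 4 * R ^ 2 * t⁻¹ := by
      rw [hηT] at hb
      have h10 : N ^ 2 ≤ R ^ 2 := by gcongr
      calc b = (24 * κ ^ 4 * t⁻¹) * (t / (24 * κ ^ 4) * b) := by field_simp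
        _ ≤ (24 * κ ^ 4 * t⁻¹) * R ^ 2 := by gcongr; exact hb.trans h10
        _ = _ := by ring
    have hvar : T * (η ^ 2 * κ ^ 4) * (2 * a ^ 2 + 3 * σ) ≤ (2 * a ^ 2 + 3 * σ) * t⁻¹ := by
      rw [h5]
      calc 1 / (576 * κ ^ 4) * t⁻¹ * (2 * a ^ 2 + 3 * σ)
          ≤ 1 * t⁻¹ * (2 * a ^ 2 + 3 * σ) := by gcongr; linarith
        _ = _ := by ring
    calc b + T * (η ^ 2 * κ ^ 4) * (2 * a ^ 2 + 3 * σ)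
        ≤ (24 * κ ^ 4 * R ^ 2 + 2 * a ^ 2 + 3 * σ) * t⁻¹ * 1 := by linarith
      _ ≤ (24 * κ ^ 4 * R ^ 2 + 2 * a ^ 2 + 3 * σ) * t⁻¹ * (Real.log T / Real.log 2) := by gcongr
      _ = _ := by rw [h4]; ring

theorem mainTheorem4 :
    -- the constant depends only on `κ`, `R`, `‖f_ρ‖_ρ` and `ℰ(f_ρ)`
    ∃ C : ℝ → ℝ → ℝ → ℝ → ℝ,
      ∀ (d : ℕ) (X : Set (EuclideanSpace ℝ (Fin d))) (_hX : IsClosed X)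
        -- the data distribution, with finite second moment of the output
        (ρ : Measure (X × ℝ)) [IsProbabilityMeasure ρ]
        (_hy : MemLp (fun p : X × ℝ => p.2) 2 ρ)
        -- the random features
        (V : Type*) [MeasurableSpace V] (μ : Measure V) [IsProbabilityMeasure μ]
        (φ : V → X → ℝ) (_hφ : Measurable (Function.uncurry φ))
        (_hφρ : MemLp (Function.uncurry φ) 2 (μ.prod ρ.fst))
        (_hφμ : ∀ x, MemLp (fun v => φ v x) 2 μ)
        -- the kernel, given by the features
        (K : X → X → ℝ) (_hKφ : ∀ x x', K x x' = ∫ v, φ v x * φ v x' ∂μ)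
        -- the reproducing kernel Hilbert space of `K`
        (H : Type*) [NormedAddCommGroup H] [InnerProductSpace ℝ H] [CompleteSpace H]
        [RKHS ℝ H X ℝ] (_hH : ∀ x x', RKHS.kernel H x x' 1 = K x x')
        -- the boundedness assumption
        (_hHsep : TopologicalSpace.SeparableSpace H)
        (_hKmeas : Measurable (Function.uncurry K))
        (κ : ℝ) (_hκ : 1 ≤ κ)
        (_hKκ : ∀ᵐ x ∂ρ.fst, K x x ≤ κ ^ 2)
        (_hφκ : ∀ᵐ p ∂(μ.prod (ρ.fst.prod ρ.fst)), φ p.1 p.2.1 * φ p.1 p.2.2 ≤ κ ^ 2)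
        -- the regression function belongs to the reproducing kernel Hilbert space
        (R : ℝ) (_hf : ∃ f : H, ‖f‖ ≤ R ∧ ⇑f =ᵐ[ρ.fst] regressionFunction ρ)
        -- the number of steps
        (T : ℕ) (_hT : 2 ≤ T)
        -- the i.i.d. samples and i.i.d. feature parameters, independent of each other
        (Ω : Type*) [MeasurableSpace Ω] (P : Measure Ω) [IsProbabilityMeasure P]
        (z : ℕ → Ω → X × ℝ) (v : ℕ → Ω → V)
        (_hlaw : ∀ t ∈ Finset.Icc 1 T, HasLaw (fun ω => (z t ω, v t ω)) (ρ.prod μ) P)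
        (_hindep : iIndepFun (fun (t : Finset.Icc 1 T) ω => (z t ω, v t ω)) P),
        ∫⁻ ω, eLpNorm (fun x =>
            doublyStochasticIterate φ 0
                (fun _ => 1 / (24 * κ ^ 4 * ((T : ℝ) ^ 2) ^ (1 / 3 : ℝ)))
                (fun t => z t ω) (fun t => v t ω) (T + 1) x
              - regressionFunction ρ x) 2 ρ.fst ^ 2 ∂P
          ≤ ENNReal.ofReal
              (C κ R (eLpNorm (regressionFunction ρ) 2 ρ.fst).toReal
                  (expectedRisk ρ (regressionFunction ρ))
                * ((T : ℝ) ^ (-(1 / 3) : ℝ) * Real.log T)) := by 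
  refine ⟨fun κ R a σ => (24 * κ ^ 4 * R ^ 2 + 2 * a ^ 2 + 3 * σ) / Real.log 2, ?_⟩
  intro d X _ ρ _ hy V _ μ _ φ hφ _ _ K hKφ H _ _ _ _ hH _ hKmeas κ hκ hKκ hφκ R hf T hT Ω _ P _ z v
    hlaw hindep
  obtain ⟨f, hfR, hfρ⟩ := hf
  have hκ0 : 0 ≤ κ := by linarith
  have hψ := measurable_clipFeature hφ κ
  have hψκ := abs_clipFeature_le φ hκ0
  have hφψ := clipFeature_ae_eq hκ0 hφκ
  obtain ⟨J, hJκ, hJ⟩ := RKHS.exists_inclusion hH hKmeas hκ0 hKκ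
  have hJL := RKHS.inner_inclusion_adjoint hH hJ hφ hψ hKφ hψκ hφψ
  have hg : J f =ᵐ[ρ.fst] regressionFunction ρ := (hJ f).trans hfρ
  obtain ⟨η, hη⟩ : ∃ η : ℝ, η = 1 / (24 * κ ^ 4 * ((T : ℝ) ^ 2) ^ (1 / 3 : ℝ)) := ⟨_, rfl⟩
  rw [← hη]
  have hσ : 0 ≤ expectedRisk ρ (regressionFunction ρ) := integral_nonneg fun _ => sq_nonneg _
  have hT' : (2 : ℝ) ≤ T := by exact_mod_cast hT
  -- This first use, with a trivial bias, extracts the step-size conditions that the actual bias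
  -- bound below requires.
  obtain ⟨hη0, hηκ, -, -⟩ := lastIterate_bound_le (a := 0) (b := 0) hκ (norm_nonneg f) hfR hσ hT'
    hη (by simp)
  have hηJ : η * ‖J‖ ^ 2 ≤ 1 := le_trans (by gcongr) hηκ
  obtain ⟨-, -, hTη, hbound⟩ := lastIterate_bound_le (a := ‖J f‖) hκ (norm_nonneg f) hfR hσ hT' hη
    (norm_gradientContraction_pow_map_le J hη0.le hηJ T f)
  obtain ⟨hYm, hYmap⟩ := map_shift_eq_pi (Y := fun t ω => (z t ω, v t ω)) hlaw hindep
  have hnorm : (eLpNorm (regressionFunction ρ) 2 ρ.fst).toReal = ‖J f‖ := by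
    rw [Lp.norm_def, eLpNorm_congr_ae hg]
  rw [hnorm]
  have hνm : (ρ.prod μ).map (fun p => p.1.1) = ρ.fst :=
    (MeasurePreserving.comp (g := Prod.fst) ⟨measurable_fst, rfl⟩
      (measurePreserving_fst (μ := ρ) (ν := μ))).map_eq
  have hxψ : ∀ᵐ p ∂(ρ.prod μ), φ p.2 p.1.1 = clipFeature φ κ p.2 p.1.1 := by
    have h1 : Measurable (fun q : (X × ℝ) × V => (q.2, q.1.1)) := by fun_prop
    refine (Measure.ae_prod_iff_ae_ae
      (p := fun p : (X × ℝ) × V => φ p.2 p.1.1 = clipFeature φ κ p.2 p.1.1)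
      (measurableSet_eq_fun (hφ.comp h1) (hψ.comp h1))).2 ?_
    exact ae_of_ae_map measurable_fst.aemeasurable
      ((Measure.ae_ae_comm (p := fun v x => φ v x = clipFeature φ κ v x)
        (measurableSet_eq_fun hφ hψ)).1 hφψ)
  have hiter := tupleIterate_congr_ae (ρ.prod μ) hφ hψ hνm hxψ
    (Measure.quasiMeasurePreserving_snd.ae hφψ) η T
  rw [← hYmap] at hiter
  calc _ = ∫⁻ ω, ENNReal.ofReal (‖(gradientContraction J η ^ 0)
          ((memLp_tupleIterate hψ hψκ η ρ.fst T (fun i => (z (i + 1) ω, v (i + 1) ω))).toLp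
            - J f)‖ ^ 2) ∂P := by
        refine lintegral_congr_ae ?_
        filter_upwards [ae_of_ae_map hYm hiter] with ω hω
        rw [pow_zero, one_apply_eq_self, ← eLpNorm_sub_sq_eq_ofReal _ hg,
          doublyStochasticIterate_eq_tupleIterate]
        congr 1
        refine eLpNorm_congr_ae ?_
        filter_upwards [hω] with x hx
        rw [hx]
    _ = ∫⁻ w, ENNReal.ofReal (‖(gradientContraction J η ^ 0)
          ((memLp_tupleIterate hψ hψκ η ρ.fst T w).toLp - J f)‖ ^ 2)
            ∂(Measure.pi fun _ => ρ.prod μ) := by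
        rw [← hYmap, lintegral_map' (measurable_norm_pow_tupleIterate hψ hψκ η
          (gradientContraction J η ^ 0) (J f) T).aemeasurable hYm]
    _ ≤ _ := lintegral_tupleIterate_le hy hψ hψκ hJL hg hη0.le hηJ T 0 hTη
    _ ≤ _ := ENNReal.ofReal_le_ofReal hbound
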